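/- Let $\mathfrak H$ be an infinite-dimensional separable complex Hilbert space, let $T$ be a bounded self-adjoint operator on $\mathfrak H$, and let $S$ be a compact self-adjoint operator on $\mathfrak H$. For a bounded self-adjoint operator $A$ let $E_\Omega(A)$ denote its spectral projection for the Borel set $\Omega\subseteq\mathbb R$, and let the essential spectrum $\sigma_{\mathrm{ess}}(A)$ be the set of all points of the spectrum $\sigma(A)$ that are not isolated eigenvalues of finite multiplicity. For $\lambda\in\mathbb R$ put $$D(\lambda)=E_{(-\infty,\lambda)}(T+S)-E_{(-\infty,\lambda)}(T).$$ Then the following assertions hold. 1. If $\lambda\in\mathbb R\setminus\sigma_{\mathrm{ess}}(T)$, then $D(\lambda)$ is a compact operator; in particular, $0\in\sigma_{\mathrm{ess}}(D(\lambda))$. 2. For all but at most countably many $\lambda\in\sigma_{\mathrm{ess}}(T)$ one has $0\in\sigma_{\mathrm{ess}}(D(\lambda))$; in particular, $D(\lambda)$ is not invertible for these $\lambda$. -/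

import Mathlib

noncomputable section

namespace SpectralDifference

open MeasureTheory CompactlySupported

variable {H : Type*} [NormedAddCommGroup H] [InnerProductSpace ℂ H] [CompleteSpace H]

/-- The positive linear functional `f ↦ ⟨f(T) x, x⟩` on `C_c(ℝ, ℝ)`, where `f(T)` is the continuous
functional calculus of the bounded self-adjoint operator `T`. -/
def spectralFunctional (T : H →L[ℂ] H) (x : H) : C_c(ℝ, ℝ) →ₚ[ℝ] ℝ where
  toFun f := (inner ℂ (cfc (f : ℝ → ℝ) T x) x).re
  map_add' f g := by
    have h := cfc_add T (f : ℝ → ℝ) g f.continuous.continuousOn g.continuous.continuousOn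
    simp only [CompactlySupportedContinuousMap.coe_add, Pi.add_def]
    rw [h]
    simp
  map_smul' c f := by
    have h := cfc_smul c (f : ℝ → ℝ) T f.continuous.continuousOn
    simp only [CompactlySupportedContinuousMap.coe_smul, Pi.smul_def]
    rw [h]
    simp
  monotone' f g hfg := by
    have h : cfc (f : ℝ → ℝ) T ≤ cfc (g : ℝ → ℝ) T :=
      cfc_mono (fun t _ => hfg t) f.continuous.continuousOn g.continuous.continuousOn
    have h2 := ((ContinuousLinearMap.le_def _ _).1 h).inner_nonneg_left x
    have h3 : 0 ≤ (inner ℂ ((cfc (g : ℝ → ℝ) T - cfc (f : ℝ → ℝ) T) x) x).re :=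
      (Complex.nonneg_iff.1 h2).1
    simpa [inner_sub_left] using h3

/-- The spectral measure `Ω ↦ ⟨E_Ω(T) x, x⟩` of `T` at the vector `x`: the regular Borel measure on
`ℝ` with `∫ f dμ = ⟨f(T) x, x⟩` for all continuous `f` with compact support. -/
def spectralMeasure (T : H →L[ℂ] H) (x : H) : Measure ℝ :=
  RealRMK.rieszMeasure (spectralFunctional T x)

theorem integral_spectralMeasure (T : H →L[ℂ] H) (x : H) (f : C_c(ℝ, ℝ)) :
    ∫ t, f t ∂(spectralMeasure T x) = (inner ℂ (cfc (f : ℝ → ℝ) T x) x).re :=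
  RealRMK.integral_rieszMeasure _ f

instance (T : H →L[ℂ] H) (x : H) : (spectralMeasure T x).Regular :=
  RealRMK.regular_rieszMeasure _

theorem spectralMeasure_le (T : H →L[ℂ] H) (x : H) (s : Set ℝ) :
    spectralMeasure T x s ≤ ENNReal.ofReal (‖x‖ ^ 2) := by
  refine (measure_mono (Set.subset_univ s)).trans ?_
  rw [isOpen_univ.measure_eq_iSup_isCompact]
  refine iSup_le fun K => iSup_le fun _ => iSup_le fun hK => ?_
  obtain ⟨f, hf1, -, hfc, hf01⟩ := exists_continuous_one_zero_of_isCompact hK isClosed_empty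
    (Set.disjoint_empty K)
  let g : C_c(ℝ, ℝ) := ⟨f, hfc⟩
  refine (RealRMK.rieszMeasure_le_of_eq_one (spectralFunctional T x) (f := g)
    (fun t => (hf01 t).1) hK (fun t ht => hf1 ht)).trans (ENNReal.ofReal_le_ofReal ?_)
  change (inner ℂ (cfc (f : ℝ → ℝ) T x) x).re ≤ _
  have hn : ‖cfc (f : ℝ → ℝ) T‖ ≤ 1 := norm_cfc_le zero_le_one fun t _ => by
    rw [Real.norm_eq_abs, abs_of_nonneg (hf01 t).1]; exact (hf01 t).2
  calc (inner ℂ (cfc (f : ℝ → ℝ) T x) x).re ≤ ‖inner ℂ (cfc (f : ℝ → ℝ) T x) x‖ :=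
        Complex.re_le_norm _
    _ ≤ ‖cfc (f : ℝ → ℝ) T x‖ * ‖x‖ := norm_inner_le_norm _ _
    _ ≤ (1 * ‖x‖) * ‖x‖ := by
        gcongr
        exact (ContinuousLinearMap.le_opNorm _ _).trans (by gcongr)
    _ = ‖x‖ ^ 2 := by ring

instance (T : H →L[ℂ] H) (x : H) : IsFiniteMeasure (spectralMeasure T x) :=
  ⟨(spectralMeasure_le T x _).trans_lt ENNReal.ofReal_lt_top⟩

theorem spectralMeasure_real_le (T : H →L[ℂ] H) (x : H) (s : Set ℝ) :
    (spectralMeasure T x).real s ≤ ‖x‖ ^ 2 :=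
  ENNReal.toReal_le_of_le_ofReal (by positivity) (spectralMeasure_le T x s)

/-- A linear relation that holds for all the forms `x ↦ ⟨f(T) x, x⟩` holds for `x ↦ μ_x(Ω)`. -/
theorem sum_spectralMeasure_eq_zero (T : H →L[ℂ] H) {Ω : Set ℝ} (hΩ : MeasurableSet Ω)
    {ι : Type*} [Fintype ι] (c : ι → ℂ) (x : ι → H)
    (h : ∀ A : H →L[ℂ] H, IsSelfAdjoint A → ∑ i, c i * inner ℂ (A (x i)) (x i) = 0) :
    ∑ i, c i * ((spectralMeasure T (x i)).real Ω : ℂ) = 0 := by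
  set ν : Measure ℝ := ∑ i, spectralMeasure T (x i) with hν
  have hmeas : ∀ i, spectralMeasure T (x i) ≤ ν := fun i =>
    Finset.single_le_sum (f := fun i => spectralMeasure T (x i)) (fun _ _ => bot_le)
      (Finset.mem_univ i)
  have hbound : ∀ ε : ℝ, 0 < ε →
      ‖∑ i, c i * ((spectralMeasure T (x i)).real Ω : ℂ)‖ ≤ (∑ i, ‖c i‖) * ε := by
    intro ε hε
    have hint : Integrable (Ω.indicator (fun _ => (1 : ℝ))) ν :=
      (integrable_const 1).indicator hΩ
    obtain ⟨g, hgc, hgε, hgcont, hgint⟩ :=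
      hint.exists_hasCompactSupport_integral_sub_le hε
    let G : C_c(ℝ, ℝ) := ⟨⟨g, hgcont⟩, hgc⟩
    have hi : ∀ i, |(spectralMeasure T (x i)).real Ω -
        (inner ℂ (cfc (G : ℝ → ℝ) T (x i)) (x i)).re| ≤ ε := by
      intro i
      rw [← integral_spectralMeasure, ← integral_indicator_one hΩ]
      have h1 : Integrable (Ω.indicator (1 : ℝ → ℝ)) (spectralMeasure T (x i)) :=
        (integrable_const (1 : ℝ)).indicator hΩ
      have h2 : Integrable g (spectralMeasure T (x i)) := hgint.mono_measure (hmeas i)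
      have h3 : Integrable (fun t => G t) (spectralMeasure T (x i)) := h2
      rw [← integral_sub h1 h3]
      refine (abs_integral_le_integral_abs).trans (le_trans ?_ hgε)
      exact integral_mono_measure (hmeas i) (Filter.Eventually.of_forall fun _ => abs_nonneg _)
        (hint.sub hgint).norm
    have hsa : IsSelfAdjoint (cfc (G : ℝ → ℝ) T) := cfc_predicate _ _
    have hre : ∀ i, inner ℂ (cfc (G : ℝ → ℝ) T (x i)) (x i) =
        ((inner ℂ (cfc (G : ℝ → ℝ) T (x i)) (x i)).re : ℂ) := fun i =>
      (Complex.conj_eq_iff_re.1 (by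
        rw [inner_conj_symm]
        exact (hsa.isSymmetric (x i) (x i)).symm)).symm
    have hz := h _ hsa
    calc ‖∑ i, c i * ((spectralMeasure T (x i)).real Ω : ℂ)‖
        = ‖∑ i, c i * (((spectralMeasure T (x i)).real Ω -
            (inner ℂ (cfc (G : ℝ → ℝ) T (x i)) (x i)).re : ℝ) : ℂ)‖ := by
          congr 1
          rw [← sub_zero (∑ i, c i * ((spectralMeasure T (x i)).real Ω : ℂ)), ← hz,
            ← Finset.sum_sub_distrib]
          refine Finset.sum_congr rfl fun i _ => ?_
          rw [hre i, Complex.ofReal_sub, mul_sub, Complex.ofReal_re]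
      _ ≤ ∑ i, ‖c i‖ * ε := by
          refine (norm_sum_le _ _).trans (Finset.sum_le_sum fun i _ => ?_)
          rw [norm_mul, Complex.norm_real]
          exact mul_le_mul_of_nonneg_left (hi i) (norm_nonneg _)
      _ = _ := (Finset.sum_mul _ _ _).symm
  have hle : ‖∑ i, c i * ((spectralMeasure T (x i)).real Ω : ℂ)‖ ≤ 0 := by
    have hC : 0 ≤ ∑ i, ‖c i‖ := Finset.sum_nonneg fun _ _ => norm_nonneg _
    refine le_of_forall_pos_le_add fun δ hδ => ?_
    refine (hbound (δ / ((∑ i, ‖c i‖) + 1)) (by positivity)).trans ?_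
    rw [zero_add, mul_div_assoc', div_le_iff₀ (by positivity)]
    nlinarith
  exact norm_le_zero_iff.1 hle

/-- The sesquilinear form `⟨E_Ω(T) x, y⟩`, obtained from the spectral measures by polarization. -/
def spectralForm (T : H →L[ℂ] H) (Ω : Set ℝ) (x y : H) : ℂ :=
  ∑ k : Fin 4, (-Complex.I) ^ (k : ℕ) / 4 *
    ((spectralMeasure T (x + Complex.I ^ (k : ℕ) • y)).real Ω : ℂ)

theorem polarization (A : H →L[ℂ] H) (x y : H) :
    ∑ k : Fin 4, (-Complex.I) ^ (k : ℕ) / 4 *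
      inner ℂ (A (x + Complex.I ^ (k : ℕ) • y)) (x + Complex.I ^ (k : ℕ) • y) =
    inner ℂ (A x) y := by
  have h3 : (Complex.I) ^ 3 = -Complex.I := by
    rw [pow_succ, Complex.I_sq]; ring
  have h3' : (-Complex.I) ^ 3 = Complex.I := by
    rw [Odd.neg_pow (by decide), h3, neg_neg]
  simp only [Fin.sum_univ_four, Fin.val_zero, Fin.val_one, Fin.val_two,
    show ((3 : Fin 4) : ℕ) = 3 from rfl, h3, h3', pow_zero, pow_one, Complex.I_sq, neg_sq,
    map_add, map_smul, inner_add_left, inner_add_right, inner_smul_left, inner_smul_right,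
    map_neg, map_one, Complex.conj_I]
  ring_nf
  simp only [Complex.I_sq]
  ring

theorem sum_spectralForm_eq_zero (T : H →L[ℂ] H) {Ω : Set ℝ} (hΩ : MeasurableSet Ω)
    {n : ℕ} (c : Fin n → ℂ) (x y : Fin n → H)
    (h : ∀ A : H →L[ℂ] H, ∑ i, c i * inner ℂ (A (x i)) (y i) = 0) :
    ∑ i, c i * spectralForm T Ω (x i) (y i) = 0 := by
  have := sum_spectralMeasure_eq_zero T hΩ
    (fun p : Fin n × Fin 4 => c p.1 * ((-Complex.I) ^ (p.2 : ℕ) / 4))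
    (fun p => x p.1 + Complex.I ^ (p.2 : ℕ) • y p.1) (fun A _ => by
      rw [← h A, Fintype.sum_prod_type]
      refine Finset.sum_congr rfl fun i _ => ?_
      rw [← polarization A, Finset.mul_sum]
      exact Finset.sum_congr rfl fun k _ => by ring)
  rw [← this, Fintype.sum_prod_type]
  refine Finset.sum_congr rfl fun i _ => ?_
  rw [spectralForm, Finset.mul_sum]
  exact Finset.sum_congr rfl fun k _ => by ring

theorem spectralForm_self (T : H →L[ℂ] H) {Ω : Set ℝ} (hΩ : MeasurableSet Ω) (x : H) :
    spectralForm T Ω x x = ((spectralMeasure T x).real Ω : ℂ) := by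
  have := sum_spectralMeasure_eq_zero T hΩ
    (fun p : Option (Fin 4) => p.elim (-1) fun k => (-Complex.I) ^ (k : ℕ) / 4)
    (fun p => p.elim x fun k => x + Complex.I ^ (k : ℕ) • x) (fun A _ => by
      rw [Fintype.sum_option]
      simp only [Option.elim]
      rw [polarization]
      ring)
  rw [Fintype.sum_option] at this
  simp only [Option.elim] at this
  rw [spectralForm]
  linear_combination this

theorem norm_spectralForm_le_of_norm_le (T : H →L[ℂ] H) (Ω : Set ℝ) {x y : H}
    (hx : ‖x‖ ≤ 1) (hy : ‖y‖ ≤ 1) : ‖spectralForm T Ω x y‖ ≤ 4 := by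
  have hk : ∀ k : Fin 4, ‖(-Complex.I) ^ (k : ℕ) / 4 *
      ((spectralMeasure T (x + Complex.I ^ (k : ℕ) • y)).real Ω : ℂ)‖ ≤ 1 := by
    intro k
    rw [norm_mul, norm_div, norm_pow, norm_neg, Complex.norm_I, one_pow, Complex.norm_real,
      Real.norm_eq_abs, abs_of_nonneg measureReal_nonneg]
    have h1 := spectralMeasure_real_le T (x + Complex.I ^ (k : ℕ) • y) Ω
    have h2 : ‖x + Complex.I ^ (k : ℕ) • y‖ ≤ 2 := by
      refine (norm_add_le _ _).trans ?_
      rw [norm_smul, norm_pow, Complex.norm_I, one_pow]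
      linarith
    have h3 : ‖x + Complex.I ^ (k : ℕ) • y‖ ^ 2 ≤ 2 ^ 2 := by gcongr
    rw [show ‖(4 : ℂ)‖ = 4 by simp]
    linarith
  refine (norm_sum_le _ _).trans ((Finset.sum_le_sum fun k _ => hk k).trans ?_)
  simp

theorem spectralForm_add_left (T : H →L[ℂ] H) {Ω : Set ℝ} (hΩ : MeasurableSet Ω) (x x' y : H) :
    spectralForm T Ω (x + x') y = spectralForm T Ω x y + spectralForm T Ω x' y := by
  have := sum_spectralForm_eq_zero T hΩ ![1, -1, -1] ![x + x', x, x'] ![y, y, y] (fun A => by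
    simp [Fin.sum_univ_three])
  simp [Fin.sum_univ_three] at this
  linear_combination this

theorem spectralForm_add_right (T : H →L[ℂ] H) {Ω : Set ℝ} (hΩ : MeasurableSet Ω) (x y y' : H) :
    spectralForm T Ω x (y + y') = spectralForm T Ω x y + spectralForm T Ω x y' := by
  have := sum_spectralForm_eq_zero T hΩ ![1, -1, -1] ![x, x, x] ![y + y', y, y'] (fun A => by
    simp [Fin.sum_univ_three])
  simp [Fin.sum_univ_three] at this
  linear_combination this

theorem spectralForm_smul_left (T : H →L[ℂ] H) {Ω : Set ℝ} (hΩ : MeasurableSet Ω)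
    (c : ℂ) (x y : H) :
    spectralForm T Ω (c • x) y = (starRingEnd ℂ) c * spectralForm T Ω x y := by
  have := sum_spectralForm_eq_zero T hΩ ![1, -(starRingEnd ℂ) c] ![c • x, x] ![y, y] (fun A => by
    simp [Fin.sum_univ_two]
    ring)
  simp [Fin.sum_univ_two] at this
  linear_combination this

theorem spectralForm_smul_right (T : H →L[ℂ] H) {Ω : Set ℝ} (hΩ : MeasurableSet Ω)
    (c : ℂ) (x y : H) :
    spectralForm T Ω x (c • y) = c * spectralForm T Ω x y := by
  have := sum_spectralForm_eq_zero T hΩ ![1, -c] ![x, x] ![c • y, y] (fun A => by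
    simp [Fin.sum_univ_two])
  simp [Fin.sum_univ_two] at this
  linear_combination this

theorem norm_spectralForm_le (T : H →L[ℂ] H) {Ω : Set ℝ} (hΩ : MeasurableSet Ω) (x y : H) :
    ‖spectralForm T Ω x y‖ ≤ 4 * ‖x‖ * ‖y‖ := by
  have hu : ∀ z : H, ‖((‖z‖⁻¹ : ℝ) : ℂ) • z‖ ≤ 1 := fun z => by
    rw [norm_smul, Complex.norm_real, norm_inv, norm_norm]
    exact inv_mul_le_one
  have hz : ∀ z : H, ((‖z‖ : ℝ) : ℂ) • ((‖z‖⁻¹ : ℝ) : ℂ) • z = z := fun z => by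
    rcases eq_or_ne z 0 with rfl | h
    · simp
    · rw [smul_smul, ← Complex.ofReal_mul, mul_inv_cancel₀ (norm_ne_zero_iff.2 h),
        Complex.ofReal_one, one_smul]
  rw [← hz x, ← hz y, spectralForm_smul_left T hΩ, spectralForm_smul_right T hΩ, hz x, hz y,
    norm_mul, norm_mul, Complex.conj_ofReal, Complex.norm_real, Complex.norm_real, norm_norm,
    norm_norm]
  have := norm_spectralForm_le_of_norm_le T Ω (hu x) (hu y)
  calc _ ≤ ‖x‖ * (‖y‖ * 4) := by gcongr
    _ = _ := by ring

/-- For every Borel set `Ω` there is exactly one bounded operator `E_Ω(T)` with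
`⟨E_Ω(T) x, x⟩ = μ_x(Ω)` for all `x`. -/
theorem existsUnique_spectralProjection (T : H →L[ℂ] H) {Ω : Set ℝ} (hΩ : MeasurableSet Ω) :
    ∃! P : H →L[ℂ] H, ∀ x, inner ℂ (P x) x = ((spectralMeasure T x).real Ω : ℂ) := by
  let B : H →L⋆[ℂ] H →L[ℂ] ℂ := LinearMap.mkContinuous₂
    (LinearMap.mk₂'ₛₗ (starRingEnd ℂ) (RingHom.id ℂ) (spectralForm T Ω)
      (spectralForm_add_left T hΩ) (spectralForm_smul_left T hΩ)
      (spectralForm_add_right T hΩ) (spectralForm_smul_right T hΩ))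
    4 (norm_spectralForm_le T hΩ)
  refine ⟨InnerProductSpace.continuousLinearMapOfBilin B, fun x => ?_, fun Q hQ => ?_⟩
  · rw [InnerProductSpace.continuousLinearMapOfBilin_apply]
    exact spectralForm_self T hΩ x
  · refine ContinuousLinearMap.ext fun x => ?_
    refine InnerProductSpace.unique_continuousLinearMapOfBilin B fun y => ?_
    change _ = spectralForm T Ω x y
    rw [← polarization Q, spectralForm]
    exact Finset.sum_congr rfl fun k _ => by rw [hQ]

/-- The spectral projection `E_Ω(T)` of the bounded self-adjoint operator `T` for a Borel set `Ω`:
the operator with `⟨E_Ω(T) x, x⟩ = μ_x(Ω)` for all `x`. -/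
def spectralProjection (T : H →L[ℂ] H) (Ω : Set ℝ) (hΩ : MeasurableSet Ω) : H →L[ℂ] H :=
  (existsUnique_spectralProjection T hΩ).choose

theorem inner_spectralProjection (T : H →L[ℂ] H) (Ω : Set ℝ) (hΩ : MeasurableSet Ω) (x : H) :
    inner ℂ (spectralProjection T Ω hΩ x) x = ((spectralMeasure T x).real Ω : ℂ) :=
  (existsUnique_spectralProjection T hΩ).choose_spec.1 x

/-- `D(lam) = E_{(-∞, lam)}(T + S) - E_{(-∞, lam)}(T)`. -/
def projectionDifference (T S : H →L[ℂ] H) (lam : ℝ) : H →L[ℂ] H :=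
  spectralProjection (T + S) (Set.Iio lam) measurableSet_Iio
    - spectralProjection T (Set.Iio lam) measurableSet_Iio

/-- The discrete spectrum of a bounded self-adjoint operator `A`: the isolated points of the
spectrum that are eigenvalues of finite multiplicity. -/
def discreteSpectrum (A : H →L[ℂ] H) : Set ℝ :=
  {t | t ∈ spectrum ℝ A ∧ ¬ AccPt t (Filter.principal (spectrum ℝ A)) ∧
    Module.End.HasEigenvalue (A : Module.End ℂ H) (t : ℂ) ∧
    FiniteDimensional ℂ (Module.End.eigenspace (A : Module.End ℂ H) (t : ℂ))}

/-- The essential spectrum of a bounded self-adjoint operator `A`: the part of the spectrum that is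
not discrete. -/
def essentialSpectrum (A : H →L[ℂ] H) : Set ℝ :=
  spectrum ℝ A \ discreteSpectrum A

end SpectralDifference

end

/-!
The difference `D(lam)` of the spectral projections is controlled by the operator
`D(lam) (T - lam)`, which is compact for every real `lam`
(`isCompactOperator_projectionDifference_mul_sub`). Indeed, writing `E(A) = E_{(-∞, lam)}(A)` and
`f(s) = min(s - lam, 0)`, one has `E(A) (A - lam) = f(A)`, where `f` is continuous although the
indicator function of the half-line is not (`spectralProjection_Iio_mul_sub`). Hence
`D(lam) (T - lam) = f(T + S) - f(T) - E(T + S) S`, and `f(T + S) - f(T)` is compact by polynomial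
approximation of `f` (`isCompactOperator_cfc_sub_cfc`).

A point `t` outside the essential spectrum of a self-adjoint operator `A` makes `A - t` invertible
modulo compact operators (`exists_parametrix`). Both assertions follow.

* If `lam` is not in the essential spectrum of `T`, then `T - lam` can be cancelled from
  `D(lam) (T - lam)` on the right, so `D(lam)` is compact. A compact operator on an
  infinite-dimensional space has no inverse modulo compact operators, so `0` is in its essential
  spectrum.
* If `0` is not in the essential spectrum of `D(lam)`, then `D(lam)` can be cancelled on the left, so
  `T - lam` is compact. In infinite dimension this happens for at most one `lam`, because the
  identity is not compact. The exceptional set therefore has at most one element.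
-/

namespace SpectralDifference

open MeasureTheory CompactlySupported

variable {H : Type*} [NormedAddCommGroup H] [InnerProductSpace ℂ H]

/-! ### Compact operators -/

theorem isCompactOperator_mul_left {K : H →L[ℂ] H} (hK : IsCompactOperator K) (A : H →L[ℂ] H) :
    IsCompactOperator (A * K) :=
  hK.clm_comp A

theorem isCompactOperator_mul_right {K : H →L[ℂ] H} (hK : IsCompactOperator K) (A : H →L[ℂ] H) :
    IsCompactOperator (K * A) :=
  hK.comp_clm A

theorem isCompactOperator_pow_sub_pow {A B : H →L[ℂ] H} (h : IsCompactOperator (A - B)) (n : ℕ) :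
    IsCompactOperator (A ^ n - B ^ n) := by
  induction n with
  | zero =>
    rw [pow_zero, pow_zero, sub_self]
    exact isCompactOperator_zero
  | succ n ih =>
    have : A ^ (n + 1) - B ^ (n + 1) = A ^ n * (A - B) + (A ^ n - B ^ n) * B := by
      rw [pow_succ, pow_succ]; noncomm_ring
    rw [this]
    exact (isCompactOperator_mul_left h _).add (isCompactOperator_mul_right ih _)

theorem isCompactOperator_aeval_sub_aeval {A B : H →L[ℂ] H} (h : IsCompactOperator (A - B))
    (q : Polynomial ℝ) : IsCompactOperator (Polynomial.aeval A q - Polynomial.aeval B q) := by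
  induction q using Polynomial.induction_on' with
  | add p q hp hq =>
    have : Polynomial.aeval A (p + q) - Polynomial.aeval B (p + q) =
        (Polynomial.aeval A p - Polynomial.aeval B p) +
          (Polynomial.aeval A q - Polynomial.aeval B q) := by
      rw [map_add, map_add]; abel
    rw [this]
    exact hp.add hq
  | monomial n a =>
    rw [Polynomial.aeval_monomial, Polynomial.aeval_monomial, ← mul_sub]
    exact isCompactOperator_mul_left (isCompactOperator_pow_sub_pow h n) _

theorem not_isCompactOperator_one (hdim : ¬ FiniteDimensional ℂ H) :
    ¬ IsCompactOperator (1 : H →L[ℂ] H) :=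
  fun h => hdim (FiniteDimensional.of_isCompactOperator_id h)

/-- If `T - a` and `T - b` are compact, then so is the scalar operator `b - a`. -/
theorem subsingleton_setOf_isCompactOperator_sub (hdim : ¬ FiniteDimensional ℂ H)
    (T : H →L[ℂ] H) :
    {t : ℝ | IsCompactOperator (T - algebraMap ℝ (H →L[ℂ] H) t)}.Subsingleton := by
  intro a ha b hb
  by_contra hab
  have hc : IsCompactOperator (algebraMap ℝ (H →L[ℂ] H) (b - a)⁻¹ *
      ((T - algebraMap ℝ (H →L[ℂ] H) a) - (T - algebraMap ℝ (H →L[ℂ] H) b))) :=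
    isCompactOperator_mul_left (IsCompactOperator.sub ha hb) _
  rw [sub_sub_sub_cancel_left, ← map_sub, ← map_mul,
    inv_mul_cancel₀ (sub_ne_zero.2 (Ne.symm hab)), map_one] at hc
  exact not_isCompactOperator_one hdim hc

/-! ### Compact perturbations and the functional calculus -/

variable [CompleteSpace H]

/-- By the Weierstrass theorem the difference is a norm limit of differences of polynomials. -/
theorem isCompactOperator_cfc_sub_cfc {A B : H →L[ℂ] H} (hA : IsSelfAdjoint A)
    (hB : IsSelfAdjoint B) (h : IsCompactOperator (A - B)) {f : ℝ → ℝ} (hf : Continuous f) :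
    IsCompactOperator (cfc f A - cfc f B) := by
  have hcl := isClosed_setOfPred_isCompactOperator (σ₁₂ := RingHom.id ℂ) (M₁ := H) (M₂ := H)
  refine hcl.closure_subset (Metric.mem_closure_iff.2 fun ε hε => ?_)
  obtain ⟨R, hR⟩ := ((spectrum.isCompact (𝕜 := ℝ) A).union
    (spectrum.isCompact (𝕜 := ℝ) B)).isBounded.subset_closedBall (0 : ℝ)
  rw [Real.closedBall_eq_Icc, zero_sub, zero_add] at hR
  obtain ⟨q, hq⟩ := exists_polynomial_near_of_continuousOn (-R) R f hf.continuousOn (ε / 4)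
    (by positivity)
  have key : ∀ C : H →L[ℂ] H, IsSelfAdjoint C → spectrum ℝ C ⊆ Set.Icc (-R) R →
      ‖cfc f C - Polynomial.aeval C q‖ ≤ ε / 4 := by
    intro C hC hs
    rw [← cfc_polynomial q C hC, ← cfc_sub f q.eval C hf.continuousOn q.continuous.continuousOn]
    refine norm_cfc_le (by positivity) fun x hx => ?_
    rw [Real.norm_eq_abs, abs_sub_comm]
    exact (hq x (hs hx)).le
  refine ⟨Polynomial.aeval A q - Polynomial.aeval B q, isCompactOperator_aeval_sub_aeval h q, ?_⟩
  have h1 := key A hA (Set.subset_union_left.trans hR)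
  have h2 := key B hB (Set.subset_union_right.trans hR)
  rw [dist_eq_norm, sub_sub_sub_comm]
  exact (norm_sub_le _ _).trans_lt (by linarith)

/-! ### Spectral projections of open sets -/

/-- Writing `P = R* R`, the hypothesis says that `R y = 0`. -/
theorem eq_zero_of_inner_apply_self_eq_zero {P : H →L[ℂ] H} (hP : P.IsPositive) {y : H}
    (hy : inner ℂ (P y) y = 0) : P y = 0 := by
  obtain ⟨R, rfl⟩ := CStarAlgebra.nonneg_iff_eq_star_mul_self.1
    ((ContinuousLinearMap.nonneg_iff_isPositive P).2 hP)
  have h : inner ℂ (R y) (R y) = 0 := by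
    rw [← hy, mul_apply_eq_comp, ContinuousLinearMap.star_eq_adjoint,
      ContinuousLinearMap.adjoint_inner_left]
  rw [mul_apply_eq_comp, inner_self_eq_zero.1 h, map_zero]

theorem isPositive_spectralProjection (A : H →L[ℂ] H) {Ω : Set ℝ} (hΩ : MeasurableSet Ω) :
    (spectralProjection A Ω hΩ).IsPositive := by
  refine (ContinuousLinearMap.isPositive_iff_complex _).2 fun x => ?_
  rw [inner_spectralProjection]
  exact ⟨rfl, measureReal_nonneg⟩

theorem isPositive_one_sub_spectralProjection (A : H →L[ℂ] H) {Ω : Set ℝ}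
    (hΩ : MeasurableSet Ω) : (1 - spectralProjection A Ω hΩ).IsPositive := by
  refine (ContinuousLinearMap.isPositive_iff_complex _).2 fun x => ?_
  have h : inner ℂ ((1 - spectralProjection A Ω hΩ) x) x =
      ((‖x‖ ^ 2 - (spectralMeasure A x).real Ω : ℝ) : ℂ) := by
    rw [sub_apply, inner_sub_left, inner_spectralProjection,
      one_apply_eq_self, inner_self_eq_norm_sq_to_K, Complex.ofReal_sub,
      Complex.ofReal_pow]
    rfl
  rw [h]
  exact ⟨rfl, sub_nonneg.2 (spectralMeasure_real_le A x Ω)⟩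

theorem isSelfAdjoint_spectralProjection (A : H →L[ℂ] H) {Ω : Set ℝ} (hΩ : MeasurableSet Ω) :
    IsSelfAdjoint (spectralProjection A Ω hΩ) :=
  (isPositive_spectralProjection A hΩ).isSelfAdjoint

theorem spectralProjection_apply_eq_zero (A : H →L[ℂ] H) {Ω : Set ℝ} (hΩ : MeasurableSet Ω)
    {y : H} (hy : spectralMeasure A y Ω = 0) : spectralProjection A Ω hΩ y = 0 := by
  refine eq_zero_of_inner_apply_self_eq_zero (isPositive_spectralProjection A hΩ) ?_
  rw [inner_spectralProjection, measureReal_def, hy]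
  simp

theorem spectralProjection_apply_eq_self (A : H →L[ℂ] H) {Ω : Set ℝ} (hΩ : MeasurableSet Ω)
    {y : H} (hy : ‖y‖ ^ 2 ≤ (spectralMeasure A y).real Ω) : spectralProjection A Ω hΩ y = y := by
  have h : (1 - spectralProjection A Ω hΩ) y = 0 := by
    refine eq_zero_of_inner_apply_self_eq_zero (isPositive_one_sub_spectralProjection A hΩ) ?_
    rw [sub_apply, inner_sub_left, inner_spectralProjection,
      one_apply_eq_self, inner_self_eq_norm_sq_to_K,
      hy.antisymm' (spectralMeasure_real_le A y Ω), Complex.ofReal_pow]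
    exact sub_self _
  exact (sub_eq_zero.1 h).symm

/-- By inner regularity it suffices to test the spectral measure of `g(A) x` on compactly supported
functions that vanish off `Ω`; their product with `g` is zero. -/
theorem spectralProjection_mul_cfc_eq_zero (A : H →L[ℂ] H) {Ω : Set ℝ} (hΩ : IsOpen Ω)
    {g : ℝ → ℝ} (hg : Continuous g) (h0 : ∀ t ∈ Ω, g t = 0) :
    spectralProjection A Ω hΩ.measurableSet * cfc g A = 0 := by
  ext x
  refine spectralProjection_apply_eq_zero A hΩ.measurableSet ?_
  rw [hΩ.measure_eq_iSup_isCompact]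
  simp only [ENNReal.iSup_eq_zero]
  intro K hKΩ hK
  obtain ⟨f, hf1, hf0, hfc, hf01⟩ := exists_continuous_one_zero_of_isCompact hK hΩ.isClosed_compl
    (Set.disjoint_compl_right_iff_subset.2 hKΩ)
  have hle := RealRMK.rieszMeasure_le_of_eq_one (spectralFunctional A (cfc g A x))
    (f := (⟨f, hfc⟩ : C_c(ℝ, ℝ))) (fun t => (hf01 t).1) hK (fun t ht => hf1 ht)
  refine le_antisymm (hle.trans_eq ?_) bot_le
  have hz : cfc (f : ℝ → ℝ) A * cfc g A = 0 := by
    rw [← cfc_mul (f : ℝ → ℝ) g A f.continuous.continuousOn hg.continuousOn]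
    have : (fun t => f t * g t) = fun _ => 0 := by
      funext t
      by_cases ht : t ∈ Ω
      · rw [h0 t ht, mul_zero]
      · rw [hf0 ht, Pi.zero_apply, zero_mul]
    rw [this, cfc_const_zero]
  change ENNReal.ofReal (inner ℂ (cfc (f : ℝ → ℝ) A (cfc g A x)) (cfc g A x)).re = 0
  rw [← mul_apply_eq_comp, hz]
  simp

/-- Cutting `g` off with a function supported in `Ω` changes `g(A)` arbitrarily little, so the
spectral measure of `g(A) x` has its full mass on `Ω`. -/
theorem spectralProjection_mul_cfc_eq_cfc (A : H →L[ℂ] H) {Ω : Set ℝ}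
    (hΩ : IsOpen Ω) {g : ℝ → ℝ} (hg : Continuous g) (h0 : ∀ t ∉ Ω, g t = 0) :
    spectralProjection A Ω hΩ.measurableSet * cfc g A = cfc g A := by
  ext x
  refine spectralProjection_apply_eq_self A hΩ.measurableSet ?_
  set y := cfc g A x with hy
  suffices h : ∀ ε > 0, ‖y‖ ^ 2 ≤ (spectralMeasure A y).real Ω + ε * (‖x‖ * ‖y‖) by
    have hlim : Filter.Tendsto (fun ε : ℝ => (spectralMeasure A y).real Ω + ε * (‖x‖ * ‖y‖))
        (nhdsWithin 0 (Set.Ioi 0)) (nhds ((spectralMeasure A y).real Ω + 0 * (‖x‖ * ‖y‖))) :=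
      ((continuous_const.add (continuous_id.mul continuous_const)).tendsto 0).mono_left
        nhdsWithin_le_nhds
    rw [zero_mul, add_zero] at hlim
    exact ge_of_tendsto hlim (Filter.eventually_of_mem self_mem_nhdsWithin h)
  intro ε hε
  -- outside this compact subset of `Ω`, a cut-off changes `g` by at most `ε` on the spectrum
  have hK : IsCompact (spectrum ℝ A ∩ {t | ε ≤ |g t|}) :=
    (spectrum.isCompact A).inter_right (isClosed_le continuous_const hg.abs)
  obtain ⟨f, hf1, hf0, hfc, hf01⟩ := exists_continuous_one_zero_of_isCompact hK hΩ.isClosed_compl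
    (Set.disjoint_compl_right_iff_subset.2 fun t ht => by
      by_contra hn
      have := ht.2
      rw [Set.mem_ofPred_eq, h0 t hn, abs_zero] at this
      linarith)
  have hmass : (inner ℂ (cfc (f : ℝ → ℝ) A y) y).re ≤ (spectralMeasure A y).real Ω := by
    have := integral_spectralMeasure A y ⟨f, hfc⟩
    change ∫ t, f t ∂_ = (inner ℂ (cfc (f : ℝ → ℝ) A y) y).re at this
    rw [← this, ← integral_indicator_one hΩ.measurableSet]
    refine integral_mono (f.continuous.integrable_of_hasCompactSupport hfc)
      ((integrable_const (1 : ℝ)).indicator hΩ.measurableSet) fun t => ?_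
    by_cases ht : t ∈ Ω
    · rw [Set.indicator_of_mem ht]
      exact (hf01 t).2
    · rw [Set.indicator_of_notMem ht, hf0 ht]
      exact le_rfl
  have hdiff : ‖y - cfc (f : ℝ → ℝ) A y‖ ≤ ε * ‖x‖ := by
    have : y - cfc (f : ℝ → ℝ) A y = cfc (fun t => g t - f t * g t) A x := by
      rw [cfc_sub g (fun t => f t * g t) A hg.continuousOn
          (f.continuous.mul hg).continuousOn,
        cfc_mul (f : ℝ → ℝ) g A f.continuous.continuousOn hg.continuousOn]
      rfl
    rw [this]
    refine (ContinuousLinearMap.le_opNorm _ _).trans ?_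
    gcongr
    refine norm_cfc_le hε.le fun t ht => ?_
    by_cases hgt : ε ≤ |g t|
    · rw [hf1 ⟨ht, hgt⟩]
      simpa using hε.le
    · have h1 := hf01 t
      rw [← one_sub_mul, norm_mul, Real.norm_eq_abs, Real.norm_eq_abs,
        abs_of_nonneg (sub_nonneg.2 h1.2)]
      nlinarith [h1.1, abs_nonneg (g t)]
  have hsplit : ‖y‖ ^ 2 = (inner ℂ (cfc (f : ℝ → ℝ) A y) y).re +
      (inner ℂ (y - cfc (f : ℝ → ℝ) A y) y).re := by
    rw [← Complex.add_re, ← inner_add_left, add_sub_cancel, inner_self_eq_norm_sq_to_K]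
    exact_mod_cast rfl
  have hcs : (inner ℂ (y - cfc (f : ℝ → ℝ) A y) y).re ≤ ε * ‖x‖ * ‖y‖ :=
    (Complex.re_le_norm _).trans ((norm_inner_le_norm _ _).trans (by gcongr))
  rw [hsplit, ← mul_assoc]
  exact add_le_add hmass hcs

/-- `E_{(-∞, lam)}(A) (A - lam) = min(A - lam, 0)`: the spectral projection of the half-line times a
continuous function that vanishes at the endpoint is a continuous function of `A`. -/
theorem spectralProjection_Iio_mul_sub {A : H →L[ℂ] H} (hA : IsSelfAdjoint A) (lam : ℝ) :
    spectralProjection A (Set.Iio lam) measurableSet_Iio * (A - algebraMap ℝ (H →L[ℂ] H) lam) =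
      cfc (fun t => min (t - lam) 0) A := by
  have hmin : Continuous fun t : ℝ => min (t - lam) 0 := by fun_prop
  have hmax : Continuous fun t : ℝ => max (t - lam) 0 := by fun_prop
  have h : A - algebraMap ℝ (H →L[ℂ] H) lam =
      cfc (fun t => min (t - lam) 0) A + cfc (fun t => max (t - lam) 0) A := by
    rw [← cfc_add A _ _ hmin.continuousOn hmax.continuousOn]
    simp only [min_add_max, add_zero]
    rw [cfc_sub (fun t => t) (fun _ => lam) A, cfc_id' ℝ A, cfc_const lam A]
  rw [h, mul_add,
    spectralProjection_mul_cfc_eq_cfc A isOpen_Iio hmin fun t ht =>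
      min_eq_right (sub_nonneg.2 (not_lt.1 ht)),
    spectralProjection_mul_cfc_eq_zero A isOpen_Iio hmax fun t ht =>
      max_eq_right (sub_nonpos.2 (le_of_lt ht)), add_zero]

/-! ### The essential spectrum -/

/-- Off the essential spectrum, `A - t` is invertible modulo compact operators. The parametrix is
`h(A)` with `h(s) = (s - t)⁻¹` for `s ≠ t` and `h(t) = 0`, which is continuous on the spectrum since
`t` is no accumulation point of it. -/
theorem exists_parametrix {A : H →L[ℂ] H} (hA : IsSelfAdjoint A) {t : ℝ}
    (ht : t ∉ essentialSpectrum A) :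
    ∃ B G : H →L[ℂ] H, IsCompactOperator G ∧ (A - algebraMap ℝ (H →L[ℂ] H) t) * B = 1 - G ∧
      B * (A - algebraMap ℝ (H →L[ℂ] H) t) = 1 - G := by
  have hsub : cfc (fun s : ℝ => s - t) A = A - algebraMap ℝ (H →L[ℂ] H) t := by
    rw [cfc_sub (fun s => s) (fun _ => t) A, cfc_id' ℝ A, cfc_const t A]
  by_cases hsp : t ∈ spectrum ℝ A
  swap
  · obtain ⟨u, hu⟩ := (spectrum.notMem_iff.1 hsp).neg
    rw [neg_sub] at hu
    refine ⟨(u⁻¹ : (H →L[ℂ] H)ˣ), 0, isCompactOperator_zero, ?_, ?_⟩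
    · rw [← hu, Units.mul_inv, sub_zero]
    · rw [← hu, Units.inv_mul, sub_zero]
  obtain ⟨-, hacc, -, hfin⟩ := not_not.1 fun h => ht ⟨hsp, h⟩
  have hcont : ContinuousOn (fun s : ℝ => (s - t)⁻¹) (spectrum ℝ A) := by
    intro s hs
    by_cases hst : s = t
    · subst hst
      rw [accPt_iff_frequently, Filter.not_frequently] at hacc
      have hev : (fun r : ℝ => (r - s)⁻¹) =ᶠ[nhdsWithin s (spectrum ℝ A)] fun _ => 0 := by
        filter_upwards [nhdsWithin_le_nhds hacc, self_mem_nhdsWithin] with r hr hrs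
        have : r = s := by
          by_contra hne
          exact hr ⟨hne, hrs⟩
        rw [this, sub_self, inv_zero]
      exact continuousWithinAt_const.congr_of_eventuallyEq hev (by simp)
    · exact ((continuousAt_id.sub continuousAt_const).inv₀ (sub_ne_zero.2 hst)).continuousWithinAt
  have hlin : ContinuousOn (fun s : ℝ => s - t) (spectrum ℝ A) :=
    (continuous_id.sub continuous_const).continuousOn
  set B := cfc (fun s : ℝ => (s - t)⁻¹) A with hB
  set L := A - algebraMap ℝ (H →L[ℂ] H) t with hL
  have hcomm : L * B = B * L := by
    rw [← hsub, hB]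
    exact cfc_commute_cfc _ _ A
  have hker : L * (1 - L * B) = 0 := by
    have : L * (L * B) = L := by
      rw [← hsub, hB, ← cfc_mul _ _ A hlin hcont,
        ← cfc_mul _ (fun s => (s - t) * (s - t)⁻¹) A hlin (hlin.mul hcont)]
      refine cfc_congr fun s _ => ?_
      by_cases hst : s = t
      · simp [hst]
      · simp [mul_inv_cancel₀ (sub_ne_zero.2 hst)]
    rw [mul_sub, mul_one, this, sub_self]
  refine ⟨B, 1 - L * B, ?_, (sub_sub_cancel _ _).symm, by rw [← hcomm, sub_sub_cancel]⟩
  -- the defect `1 - L * B` has its range in the eigenspace, which is finite-dimensional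
  set V := Module.End.eigenspace (A : Module.End ℂ H) (t : ℂ)
  have hV : ∀ x, (1 - L * B) x ∈ V := fun x => by
    have h := DFunLike.congr_fun hker x
    rw [mul_apply_eq_comp, hL, sub_apply] at h
    exact Module.End.mem_eigenspace_iff.2 (sub_eq_zero.1 h)
  exact (isCompactOperator_of_locallyCompactSpace_rng V.subtypeL).comp_clm
    ((1 - L * B).codRestrict V hV)

/-- A factor whose essential spectrum omits `0` can be cancelled modulo compact operators. -/
theorem isCompactOperator_of_isCompactOperator_mul {D M : H →L[ℂ] H} (hD : IsSelfAdjoint D)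
    (h0 : (0 : ℝ) ∉ essentialSpectrum D) (h : IsCompactOperator (D * M)) :
    IsCompactOperator M := by
  obtain ⟨B, G, hG, -, hB⟩ := exists_parametrix hD h0
  rw [map_zero, sub_zero] at hB
  have : M = B * (D * M) + G * M := by
    rw [← mul_assoc, hB]; noncomm_ring
  rw [this]
  exact (isCompactOperator_mul_left h B).add (isCompactOperator_mul_right hG M)

/-! ### The difference of the spectral projections -/

theorem isSelfAdjoint_projectionDifference (T S : H →L[ℂ] H) (lam : ℝ) :
    IsSelfAdjoint (projectionDifference T S lam) :=
  (isSelfAdjoint_spectralProjection _ _).sub (isSelfAdjoint_spectralProjection _ _)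

theorem isCompactOperator_projectionDifference_mul_sub {T S : H →L[ℂ] H} (hT : IsSelfAdjoint T)
    (hS : IsSelfAdjoint S) (hSc : IsCompactOperator S) (lam : ℝ) :
    IsCompactOperator (projectionDifference T S lam * (T - algebraMap ℝ (H →L[ℂ] H) lam)) := by
  have h : projectionDifference T S lam * (T - algebraMap ℝ (H →L[ℂ] H) lam) =
      (cfc (fun t => min (t - lam) 0) (T + S) - cfc (fun t => min (t - lam) 0) T) -
        spectralProjection (T + S) (Set.Iio lam) measurableSet_Iio * S := by
    rw [← spectralProjection_Iio_mul_sub hT lam, ← spectralProjection_Iio_mul_sub (hT.add hS) lam,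
      projectionDifference]
    noncomm_ring
  rw [h]
  refine (isCompactOperator_cfc_sub_cfc (hT.add hS) hT ?_ (by fun_prop)).sub
    (isCompactOperator_mul_left hSc _)
  rwa [add_sub_cancel_left]

theorem isCompactOperator_projectionDifference {T S : H →L[ℂ] H} (hT : IsSelfAdjoint T)
    (hS : IsSelfAdjoint S) (hSc : IsCompactOperator S) {lam : ℝ}
    (hlam : lam ∉ essentialSpectrum T) : IsCompactOperator (projectionDifference T S lam) := by
  obtain ⟨B, G, hG, hB, -⟩ := exists_parametrix hT hlam
  have : projectionDifference T S lam =
      projectionDifference T S lam * (T - algebraMap ℝ (H →L[ℂ] H) lam) * B +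
        projectionDifference T S lam * G := by
    rw [mul_assoc, hB]; noncomm_ring
  rw [this]
  exact (isCompactOperator_mul_right
    (isCompactOperator_projectionDifference_mul_sub hT hS hSc lam) B).add
    (isCompactOperator_mul_left hG _)

end SpectralDifference

theorem mainTheorem4 {H : Type*} [NormedAddCommGroup H] [InnerProductSpace ℂ H] [CompleteSpace H]
    [TopologicalSpace.SeparableSpace H] (hdim : ¬ FiniteDimensional ℂ H)
    (T S : H →L[ℂ] H) (hT : IsSelfAdjoint T) (hS : IsSelfAdjoint S) (hSc : IsCompactOperator S) :
    (∀ lam : ℝ, lam ∉ SpectralDifference.essentialSpectrum T →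
      IsCompactOperator (SpectralDifference.projectionDifference T S lam) ∧
      (0 : ℝ) ∈ SpectralDifference.essentialSpectrum
        (SpectralDifference.projectionDifference T S lam)) ∧
    (∃ N : Set ℝ, N ⊆ SpectralDifference.essentialSpectrum T ∧ N.Countable ∧
      ∀ lam ∈ SpectralDifference.essentialSpectrum T \ N,
        (0 : ℝ) ∈ SpectralDifference.essentialSpectrum
          (SpectralDifference.projectionDifference T S lam) ∧
        ¬ IsUnit (SpectralDifference.projectionDifference T S lam)) := by
  have hD := SpectralDifference.isSelfAdjoint_projectionDifference T S
  refine ⟨fun lam hlam => ?_, {t ∈ SpectralDifference.essentialSpectrum T |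
    IsCompactOperator (T - algebraMap ℝ (H →L[ℂ] H) t)}, fun t ht => ht.1, ?_,
    fun lam hlam => ?_⟩
  · have hc := SpectralDifference.isCompactOperator_projectionDifference hT hS hSc hlam
    refine ⟨hc, by_contra fun h0 => SpectralDifference.not_isCompactOperator_one hdim ?_⟩
    refine SpectralDifference.isCompactOperator_of_isCompactOperator_mul (hD lam) h0 ?_
    rwa [mul_one]
  · exact ((SpectralDifference.subsingleton_setOf_isCompactOperator_sub hdim T).anti
      fun t ht => ht.2).countable
  · have h0 : (0 : ℝ) ∈ SpectralDifference.essentialSpectrum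
        (SpectralDifference.projectionDifference T S lam) :=
      by_contra fun h0 => hlam.2 ⟨hlam.1,
        SpectralDifference.isCompactOperator_of_isCompactOperator_mul (hD lam) h0
          (SpectralDifference.isCompactOperator_projectionDifference_mul_sub hT hS hSc lam)⟩
    exact ⟨h0, spectrum.zero_mem_iff ℝ |>.1 h0.1⟩
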